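/- **Setting.** There are $n$ agents with nonnegative edge weights $W\in\mathbb{R}^{n\times n}$, $W_{jj}=0$, degrees $D_{jj}=\sum_k W_{jk}$, neighborhoods $\mathcal{N}_j=\{k: W_{jk}>0\}$, a trade-off parameter $\mu>0$ and confidences $c_j\in(0,1]$. Agent $j$ holds a dataset $\mathcal{S}_j\in(\mathcal{X}\times\mathcal{Y})^{m_j}$ and has a local loss $\mathcal{L}_j(\cdot\,;\mathcal{S}_j)$ on $\mathbb{R}^p$ which, for every dataset of size $m_j$, is differentiable with $L_j^{loc}$-Lipschitz gradient. Put $\alpha_j=1/(1+\mu c_jL_j^{loc})$. The algorithm runs for $T$ iterations $t=0,\dots,T-1$ with a given wake-up schedule. When agent $j$ wakes up at iteration $t$ it sets $$\widetilde\Theta_j(t+1)=(1-\alpha_j)\widetilde\Theta_j(t)+\alpha_j\Big(\sum_{k\in\mathcal{N}_j}\frac{W_{jk}}{D_{jj}}\widetilde\Theta_k(t)-\mu c_j\big(\nabla\mathcal{L}_j(\widetilde\Theta_j(t);\mathcal{S}_j)+\eta_j(t)\big)\Big)$$ and broadcasts it, while the other models stay unchanged. Here $\eta_j(t)\sim \mathrm{Laplace}(0,s_j(t))^p$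 with $s_j(t)\ge 0$ (and $\mathrm{Laplace}(0,0)=0$ almost surely), and the noise vectors are independent of each other and of the (possibly random) initial point $\widetilde\Theta(0)\in\mathbb{R}^{np}$. A mechanism $\mathcal{M}$ is $(\epsilon,\delta)$-differentially private if $\Pr(\mathcal{M}(\mathcal{S})\in\mathcal{O})\le e^{\epsilon}\Pr(\mathcal{M}(\mathcal{S}')\in\mathcal{O})+\delta$ for all datasets $\mathcal{S},\mathcal{S}'$ of the same size differing in a single data point and all measurable sets $\mathcal{O}$ of outputs. **Theorem (Differential privacy of $\mathcal{M}_i$).** Let $i\in\{1,\dots,n\}$ with $m_i\ge 1$, and let $\mathcal{T}_i$ be the set of iterations at which agent $i$ wakes up. Assume that $$\mathcal{L}_i(\theta;\mathcal{S}_i)=\frac1{m_i}\sum_{k=1}^{m_i}\ell(\theta;x_i^k,y_i^k)+\lambda_i\|\theta\|_2^2,\qquad \lambda_i\ge 0,$$ where for every $(x,y)\in\mathcal{X}\times\mathcal{Y}$ the loss $\ell(\cdot\,;x,y)$ is differentiable and $L_0$-Lipschitz as measured in the $L_1$-norm, in the sense that $\|\nabla\ell(\theta;x,y)\|_1\le L_0$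 for all $\theta\in\mathbb{R}^p$. For every $t\in\mathcal{T}_i$ let $s_i(t)=\frac{2L_0}{\epsilon_i(t)\,m_i}$ for some $\epsilon_i(t)>0$. Then for every $\bar\delta_i\in[0,1]$ and every initial point $\widetilde\Theta(0)$ that does not depend on $\mathcal{S}_i$, the mechanism $\mathcal{M}_i(\mathcal{S}_i)=\big(\widetilde\Theta_i(t+1)\big)_{t\in\mathcal{T}_i}$, the datasets of the other agents being fixed, is $(\bar\epsilon_i,\bar\delta_i)$-differentially private with $$\bar\epsilon_i=\min\Big\{\sum_{t\in\mathcal{T}_i}\epsilon_i(t),\ \sum_{t\in\mathcal{T}_i}\tfrac{(e^{\epsilon_i(t)}-1)\epsilon_i(t)}{e^{\epsilon_i(t)}+1}+\sqrt{\textstyle\sum_{t\in\mathcal{T}_i}2\epsilon_i(t)^2\log\big(e+\sqrt{\sum_{t\in\mathcal{T}_i}\epsilon_i(t)^2}/\bar\delta_i\big)},\ \sum_{t\in\mathcal{T}_i}\tfrac{(e^{\epsilon_i(t)}-1)\epsilon_i(t)}{e^{\epsilon_i(t)}+1}+\sqrt{\textstyle\sum_{t\in\mathcal{T}_i}2\epsilon_i(t)^2\log(1/\bar\delta_i)}\Big\},$$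 where for $\bar\delta_i=0$ the last two expressions are read as $+\infty$, so that $\bar\epsilon_i=\sum_{t\in\mathcal{T}_i}\epsilon_i(t)$. -/

import Mathlib

open MeasureTheory ProbabilityTheory
open scoped NNReal ENNReal

noncomputable section

/-- The model space `ℝ^p`, with its Euclidean norm. -/
abbrev Params (p : ℕ) := EuclideanSpace ℝ (Fin p)

/-- A local dataset of `m` labelled examples. -/
abbrev Dataset (X Y : Type*) (m : ℕ) := Fin m → X × Y

/-- Two datasets of the same size differ in (at most) a single data point. -/
def Neighboring {Z : Type*} {m : ℕ} (S S' : Fin m → Z) : Prop :=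
  ∃ k, ∀ j, j ≠ k → S j = S' j

/-- `(ε, δ)`-differential privacy of the randomized mechanism `M`, whose randomness is the outcome
`ω` of a probability space with law `Pr`. -/
def IsDifferentiallyPrivate {Ω Z Out : Type*} [MeasurableSpace Ω] [MeasurableSpace Out] {m : ℕ}
    (Pr : Measure Ω) (M : (Fin m → Z) → Ω → Out) (ε δ : ℝ) : Prop :=
  ∀ S S' : Fin m → Z, Neighboring S S' → ∀ O : Set Out, MeasurableSet O →
    Pr {ω | M S ω ∈ O} ≤
      ENNReal.ofReal (Real.exp ε) * Pr {ω | M S' ω ∈ O} + ENNReal.ofReal δ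

/-- The law `Laplace(0, s)` on `ℝ`, with the convention that `Laplace(0, 0)` is the point mass
at `0`. -/
def laplaceMeasure (s : ℝ) : Measure ℝ :=
  if s = 0 then Measure.dirac 0
  else volume.withDensity fun x => ENNReal.ofReal (Real.exp (-|x| / s) / (2 * s))

/-- The law `Laplace(0, s)^p` on `ℝ^p`: independent `Laplace(0, s)` coordinates. -/
def laplaceVector (p : ℕ) (s : ℝ) : Measure (Params p) :=
  (Measure.pi fun _ : Fin p => laplaceMeasure s).map (WithLp.toLp 2)

/-- The differentiable function `f` is `L`-Lipschitz as measured in the `L1`-norm: its gradient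
has `L1`-norm at most `L` everywhere. -/
def LipschitzInL1 {p : ℕ} (f : Params p → ℝ) (L : ℝ) : Prop :=
  Differentiable ℝ f ∧ ∀ θ, ∑ k, |gradient f θ k| ≤ L

/-- The data of the peer-to-peer personalized learning problem for `n` agents with models in `ℝ^p`
and local datasets of sizes `m j`. Neither symmetry nor connectedness of the weights, nor
convexity of the local losses, is imposed. -/
structure LearningProblem (n p : ℕ) (m : Fin n → ℕ) (X Y : Type*) where
  /-- edge weights -/
  W : Matrix (Fin n) (Fin n) ℝ
  W_nonneg : ∀ j k, 0 ≤ W j k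
  W_self : ∀ j, W j j = 0
  /-- trade-off parameter -/
  μ : ℝ
  μ_pos : 0 < μ
  /-- confidences -/
  c : Fin n → ℝ
  c_mem : ∀ j, c j ∈ Set.Ioc (0 : ℝ) 1
  /-- the local loss of agent `j` as a function of the model and of the local dataset -/
  localLoss : ∀ j, Params p → Dataset X Y (m j) → ℝ
  /-- Lipschitz constants of the gradients of the local losses -/
  Lloc : Fin n → ℝ≥0
  differentiable_localLoss : ∀ j S, Differentiable ℝ fun θ => localLoss j θ S
  lipschitz_gradient : ∀ j S, LipschitzWith (Lloc j) (gradient fun θ => localLoss j θ S)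

namespace LearningProblem

variable {n p : ℕ} {m : Fin n → ℕ} {X Y : Type*}

/-- The degrees `D_jj = ∑ k, W_jk`. -/
def degree (P : LearningProblem n p m X Y) (j : Fin n) : ℝ := ∑ k, P.W j k

/-- The step size `α = 1 / (1 + μ c_j L_j^loc)`. -/
def stepSize (P : LearningProblem n p m X Y) (j : Fin n) : ℝ :=
  1 / (1 + P.μ * P.c j * P.Lloc j)

/-- The new model of agent `j`, holding the dataset `S`, when it wakes up in the global state `Θ`
and draws the noise vector `η`. The first sum runs over the neighborhood of `j`. -/
def noisyUpdate (P : LearningProblem n p m X Y) (j : Fin n) (S : Dataset X Y (m j))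
    (Θ : Fin n → Params p) (η : Params p) : Params p :=
  (1 - P.stepSize j) • Θ j +
    P.stepSize j •
      ((∑ k with 0 < P.W j k, (P.W j k / P.degree j) • Θ k) -
        (P.μ * P.c j) • (gradient (fun θ => P.localLoss j θ S) (Θ j) + η))

/-- The noisy iterates `Θ(0), …, Θ(T)`: at iteration `t` the agent `w t` wakes up and updates its
model with the noise `η t`, all other models being unchanged. -/
def iterates (P : LearningProblem n p m X Y) {T : ℕ} (w : Fin T → Fin n)
    (S : ∀ j, Dataset X Y (m j)) (Θ₀ : Fin n → Params p) (η : Fin T → Params p) :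
    Fin (T + 1) → Fin n → Params p :=
  Fin.induction Θ₀ fun t Θ =>
    Function.update Θ (w t) (P.noisyUpdate (w t) (S (w t)) Θ (η t))

/-- The sequence of noisy iterates `Θ_i(t + 1)` broadcast by agent `i`, indexed by the iterations
`t` at which `i` wakes up. -/
def broadcast (P : LearningProblem n p m X Y) {T : ℕ} (w : Fin T → Fin n) (i : Fin n)
    (S : ∀ j, Dataset X Y (m j)) (Θ₀ : Fin n → Params p) (η : Fin T → Params p) :
    {t : Fin T // w t = i} → Params p :=
  fun t => P.iterates w S Θ₀ η t.1.succ i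

/-- The mechanism `M_i` of agent `i`: it maps the local dataset `Si` of `i` to the (random)
sequence of iterates broadcast by `i`, the datasets `S j` of the other agents being fixed. -/
def mechanism (P : LearningProblem n p m X Y) {T : ℕ} (w : Fin T → Fin n) (i : Fin n)
    (S : ∀ j, Dataset X Y (m j)) {Ω : Type*} (Θ₀ : Ω → Fin n → Params p)
    (η : Fin T → Ω → Params p) (Si : Dataset X Y (m i)) (ω : Ω) :
    {t : Fin T // w t = i} → Params p :=
  P.broadcast w i (Function.update S i Si) (Θ₀ ω) fun t => η t ω

end LearningProblem

/-- The overall privacy parameter: the minimum of the sum of the `ε t` and of two further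
bounds. For `δ = 0` the logarithms in these two bounds are `+∞`, and the minimum is the sum. -/
def overallEpsilon {ι : Type*} (A : Finset ι) (ε : ι → ℝ) (δ : ℝ) : ℝ :=
  if δ = 0 then ∑ t ∈ A, ε t
  else
    min (∑ t ∈ A, ε t)
      (min
        ((∑ t ∈ A, (Real.exp (ε t) - 1) * ε t / (Real.exp (ε t) + 1)) +
          √(∑ t ∈ A, 2 * ε t ^ 2 * Real.log (Real.exp 1 + √(∑ r ∈ A, ε r ^ 2) / δ)))
        ((∑ t ∈ A, (Real.exp (ε t) - 1) * ε t / (Real.exp (ε t) + 1)) +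
          √(∑ t ∈ A, 2 * ε t ^ 2 * Real.log (1 / δ))))

end

noncomputable section

/-! ### Integration over finite products, one coordinate at a time -/

/-! Given the current state, changing one data point of agent `i` moves the gradient in its update
by a vector `d` of L1-norm at most `2 * L₀ / m i`. Noise is added to that gradient, so the change is
the same as translating the Laplace noise by `d`. The likelihood ratio of this translation lies in
`[exp (-ε), exp ε]` and has mean one. Steps of other agents use the same data under both datasets
and contribute ratio one.

By convexity, such a ratio has no larger `(1 + l)`-th moment than that of `ε`-randomized response
(`lintegral_rpow_le_responseMoment`). These bounds hold uniformly in the state, so they multiply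
along the adaptive trajectory (`lintegral_trajectory_le`). The inequality `a ≤ exp κ + C * exp (-(l
* κ)) * a ^ (1 + l)` turns the moment bound into an `(κ, δ)` guarantee.

All three expressions in `overallEpsilon` come from choices of `l`, `C`, `κ`
(`le_exp_overallEpsilon`): `l → ∞` gives pure composition. The other two use Hoeffding's lemma with
the optimal `l`, and `C = 1 / l` or `C = 1`. A random initial point, being independent of the noise,
is integrated out last. -/

theorem lintegral_pi_fin_succ {E : Type*} [MeasurableSpace E] {T : ℕ}
    (ν : Fin (T + 1) → Measure E) [∀ t, SigmaFinite (ν t)]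
    {F : (Fin (T + 1) → E) → ℝ≥0∞} (hF : Measurable F) :
    ∫⁻ η, F η ∂Measure.pi ν =
      ∫⁻ x, ∫⁻ y, F (Fin.cons x y) ∂(Measure.pi fun t => ν t.succ) ∂(ν 0) := by
  have h := (measurePreserving_piFinSuccAbove ν 0).symm
  rw [← h.lintegral_comp hF, lintegral_prod]
  · simp only [Fin.succAbove_zero]
    refine lintegral_congr fun x => lintegral_congr fun y => ?_
    congr 1
    exact Fin.insertNth_zero' x y
  · exact (hF.comp (MeasurableEquiv.measurable _)).aemeasurable

theorem measurable_fin_cons {E : Type*} [MeasurableSpace E] {T : ℕ} :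
    Measurable fun z : E × (Fin T → E) => (Fin.cons z.1 z.2 : Fin (T + 1) → E) := by
  refine measurable_pi_iff.2 fun k => ?_
  refine Fin.cases ?_ (fun k => ?_) k
  · simpa using measurable_fst
  · simpa using! (measurable_pi_apply k).comp measurable_snd

/-! ### Adaptive composition -/

/-- The trajectory started at `a` of the recursion whose step `t` is driven by the noise `η t`. -/
def trajectory {A E : Type*} {T : ℕ} (f : Fin T → A → E → A) (a : A) (η : Fin T → E) :
    Fin (T + 1) → A :=
  Fin.induction a fun t x => f t x (η t)

/-- `Fin.induction` unfolds at the last step. The composition argument instead conditions on the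
first noise vector and restarts from the state it produces. -/
theorem trajectory_cons {A E : Type*} {T : ℕ} (f : Fin (T + 1) → A → E → A) (a : A)
    (x : E) (y : Fin T → E) :
    trajectory f a (Fin.cons x y : Fin (T + 1) → E) =
      Fin.cons a (trajectory (fun t => f t.succ) (f 0 a x) y) := by
  funext k
  refine Fin.cases rfl (fun k => ?_) k
  rw [Fin.cons_succ]
  induction k using Fin.induction with
  | zero => rfl
  | succ k ih =>
    have h₁ : trajectory f a (Fin.cons x y : Fin (T + 1) → E) k.succ.succ =
      f k.succ (trajectory f a (Fin.cons x y : Fin (T + 1) → E) k.castSucc.succ) (y k) := rfl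
    rw [h₁, ih]
    rfl

theorem measurable_trajectory {A E : Type*} [MeasurableSpace A] [MeasurableSpace E] {T : ℕ}
    {f : Fin T → A → E → A} (hf : ∀ t, Measurable (Function.uncurry (f t))) :
    Measurable fun z : A × (Fin T → E) => trajectory f z.1 z.2 := by
  refine measurable_pi_iff.2 fun k => ?_
  induction k using Fin.induction with
  | zero => exact measurable_fst
  | succ k ih =>
    exact (hf k).comp (ih.prodMk ((measurable_pi_apply k).comp measurable_snd))

/-- `r` is a likelihood ratio: it turns the law of `g` under `ν` into the law of `f`. -/
def IsLikelihoodRatio {A E : Type*} [MeasurableSpace A] [MeasurableSpace E] (ν : Measure E)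
    (f g : E → A) (r : E → ℝ≥0∞) : Prop :=
  Measurable r ∧ ∀ H : A → ℝ≥0∞, Measurable H →
    ∫⁻ y, H (f y) ∂ν = ∫⁻ y, r y * H (g y) ∂ν

/-- Adaptive composition: if the likelihood ratio of each step has `q`-th moment at most `K t`,
whatever the state, then the laws of the trajectories are close in hockey-stick divergence. -/
theorem lintegral_trajectory_le {A E : Type*} [MeasurableSpace A] [MeasurableSpace E]
    {q : ℝ} (hq : 0 ≤ q) {b C : ℝ≥0∞} (hC : ∀ a, a ≤ b + C * a ^ q) {T : ℕ}
    (ν : Fin T → Measure E) [∀ t, IsProbabilityMeasure (ν t)]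
    {f g : Fin T → A → E → A} (hf : ∀ t, Measurable (Function.uncurry (f t)))
    (hg : ∀ t, Measurable (Function.uncurry (g t))) (K : Fin T → ℝ≥0∞)
    (hr : ∀ t x, ∃ r, IsLikelihoodRatio (ν t) (f t x) (g t x) r ∧ ∫⁻ y, r y ^ q ∂ν t ≤ K t)
    {G : (Fin (T + 1) → A) → ℝ≥0∞} (hG : Measurable G) (hG1 : ∀ z, G z ≤ 1)
    (x : A) (a : ℝ≥0∞) :
    a * ∫⁻ η, G (trajectory f x η) ∂Measure.pi ν ≤
      b * ∫⁻ η, G (trajectory g x η) ∂Measure.pi ν + C * a ^ q * ∏ t, K t := by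
  induction T generalizing x a with
  | zero =>
    have h : ∀ (f : Fin 0 → A → E → A) η, trajectory f x η = fun _ => x := by
      intro f η; funext k; rw [Fin.fin_one_eq_zero k]; rfl
    simp only [h, lintegral_const, measure_univ, mul_one, Finset.univ_eq_empty,
      Finset.prod_empty]
    -- With no step left, `a` is the accumulated likelihood ratio, and the pointwise inequality `hC`
    -- is applied to it.
    calc a * G _ ≤ (b + C * a ^ q) * G _ := by gcongr; exact hC a
      _ = b * G _ + C * a ^ q * G _ := add_mul _ _ _
      _ ≤ b * G _ + C * a ^ q * 1 := by gcongr; exact hG1 _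
      _ = _ := by rw [mul_one]
  | succ T ih =>
    have hmeas : ∀ {f : Fin (T + 1) → A → E → A},
        (∀ t, Measurable (Function.uncurry (f t))) →
        Measurable fun η => G (trajectory f x η) := fun hf =>
      hG.comp ((measurable_trajectory hf).comp measurable_prodMk_left)
    have hcons : Measurable fun z : Fin (T + 1) → A => G (Fin.cons x z) :=
      hG.comp (measurable_fin_cons.comp measurable_prodMk_left)
    have hinner : Measurable fun x' => ∫⁻ η, G (Fin.cons x
        (trajectory (fun t => f t.succ) x' η)) ∂(Measure.pi fun t => ν t.succ) :=
      Measurable.lintegral_prod_right'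
        (hcons.comp (measurable_trajectory fun t => hf t.succ))
    obtain ⟨r, ⟨hrm, hrH⟩, hrK⟩ := hr 0 x
    rw [lintegral_pi_fin_succ ν (hmeas hf), lintegral_pi_fin_succ ν (hmeas hg)]
    simp only [trajectory_cons]
    rw [hrH _ hinner]
    have hgx : Measurable (g 0 x) := (hg 0).comp measurable_prodMk_left
    have hinner' : Measurable fun y => ∫⁻ η, G (Fin.cons x
        (trajectory (fun t => g t.succ) (g 0 x y) η)) ∂(Measure.pi fun t => ν t.succ) :=
      (Measurable.lintegral_prod_right'
        (hcons.comp (measurable_trajectory fun t => hg t.succ))).comp hgx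
    have hrinner : Measurable fun y => r y * ∫⁻ η, G (Fin.cons x
        (trajectory (fun t => f t.succ) (g 0 x y) η)) ∂(Measure.pi fun t => ν t.succ) :=
      hrm.mul (hinner.comp hgx)
    rw [← lintegral_const_mul _ hrinner, ← lintegral_const_mul _ hinner']
    refine (lintegral_mono fun y => ?_).trans
      ((lintegral_add_left (hinner'.const_mul b) fun y =>
        (C * a ^ q * ∏ t : Fin T, K t.succ) * r y ^ q).trans_le ?_)
    -- The induction hypothesis is used with weight `a * r y`: the ratio of the first step is
    -- absorbed into the accumulated one, so only its `q`-th moment remains to be integrated.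
    · have := ih (fun t => ν t.succ) (fun t => hf t.succ) (fun t => hg t.succ)
        (fun t => K t.succ) (fun t => hr t.succ) hcons (fun z => hG1 _) (g 0 x y) (a * r y)
      rw [← mul_assoc]
      refine this.trans (le_of_eq ?_)
      rw [ENNReal.mul_rpow_of_nonneg _ _ hq]
      ring
    · refine add_le_add_right ?_ _
      rw [lintegral_const_mul _ (hrm.pow_const q), Fin.prod_univ_succ]
      calc _ ≤ (C * a ^ q * ∏ t : Fin T, K t.succ) * K 0 := by gcongr
        _ = _ := by ring

/-! ### Translating Laplace noise -/

/-- σ-finiteness suffices for product integrals; total mass one is later inherited from the noise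
having this law. -/
instance sigmaFinite_laplaceMeasure (s : ℝ) : SigmaFinite (laplaceMeasure s) := by
  unfold laplaceMeasure
  split_ifs <;> infer_instance

/-- Translation invariance of Lebesgue measure reduces this to a quotient of densities. For `s = 0`
no translation is allowed, and division by zero makes the ratio `1`. -/
theorem isLikelihoodRatio_laplaceMeasure {s d : ℝ} (hs : 0 ≤ s) (hd : s = 0 → d = 0) :
    IsLikelihoodRatio (laplaceMeasure s) (fun x => x + d) id
      fun x => ENNReal.ofReal (Real.exp ((|x| - |x - d|) / s)) := by
  refine ⟨by fun_prop, fun H hH => ?_⟩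
  rcases hs.eq_or_lt with rfl | hs'
  · simp [laplaceMeasure, hd rfl]
  · have hm : ∀ d : ℝ, Measurable fun x : ℝ =>
        ENNReal.ofReal (Real.exp (-|x - d| / s) / (2 * s)) := fun d => by fun_prop
    have hm₀ : Measurable fun x : ℝ => ENNReal.ofReal (Real.exp (-|x| / s) / (2 * s)) := by
      fun_prop
    rw [laplaceMeasure, if_neg hs'.ne', lintegral_withDensity_eq_lintegral_mul _ hm₀ (by fun_prop),
      lintegral_withDensity_eq_lintegral_mul _ hm₀ (by fun_prop),
      ← lintegral_sub_right_eq_self _ d]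
    refine lintegral_congr fun x => ?_
    simp only [Pi.mul_apply, sub_add_cancel, id]
    rw [← mul_assoc, ← ENNReal.ofReal_mul (by positivity)]
    congr 2
    rw [div_mul_eq_mul_div, ← Real.exp_add]
    congr 2
    ring

/-- Likelihood ratios of independent coordinates multiply, by Fubini and induction on the number of
coordinates. -/
theorem isLikelihoodRatio_pi {E : Type*} [MeasurableSpace E] {p : ℕ} (ν : Fin p → Measure E)
    [∀ k, SigmaFinite (ν k)] {f : Fin p → E → E} (hf : ∀ k, Measurable (f k))
    {r : Fin p → E → ℝ≥0∞}
    (hr : ∀ k, IsLikelihoodRatio (ν k) (f k) id (r k)) :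
    IsLikelihoodRatio (Measure.pi ν) (fun x k => f k (x k)) id fun x => ∏ k, r k (x k) := by
  refine ⟨Finset.measurable_prod _ fun k _ => (hr k).1.comp (measurable_pi_apply k), ?_⟩
  induction p with
  | zero =>
    intro H hH
    refine lintegral_congr fun y => ?_
    simp [Subsingleton.elim (fun k => f k (y k)) y]
  | succ p ih =>
    intro H hH
    have hc : ∀ x, Measurable fun y : Fin p → E => H (Fin.cons x y) := fun x =>
      hH.comp (measurable_fin_cons.comp measurable_prodMk_left)
    have hF : Measurable fun (x : Fin (p + 1) → E) k => f k (x k) :=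
      measurable_pi_iff.2 fun k => (hf k).comp (measurable_pi_apply k)
    have hR : ∀ (p : ℕ) (r : Fin p → E → ℝ≥0∞), (∀ k, Measurable (r k)) →
      Measurable fun x : Fin p → E => ∏ k, r k (x k) := fun p r hr =>
        Finset.measurable_prod _ fun k _ => (hr k).comp (measurable_pi_apply k)
    rw [show (fun y : Fin (p + 1) → E => (fun x => ∏ k, r k (x k)) y * H (id y)) =
      fun y => (∏ k, r k (y k)) * H y from rfl, lintegral_pi_fin_succ ν (F := fun y => H fun k => f k (y k)) (hH.comp hF),
      lintegral_pi_fin_succ ν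
      (F := fun y => (∏ k, r k (y k)) * H y) ((hR _ r fun k => (hr k).1).mul hH)]
    have hcons : ∀ x (y : Fin p → E), (fun k => f k ((Fin.cons x y : Fin (p + 1) → E) k)) =
        (Fin.cons (f 0 x) fun k => f k.succ (y k) : Fin (p + 1) → E) := by
      intro x y; funext k; refine Fin.cases ?_ (fun k => ?_) k <;> simp
    simp only [hcons]
    have h₁ : ∀ x, ∫⁻ y, H (Fin.cons (f 0 x) fun k => f k.succ (y k))
          ∂(Measure.pi fun k => ν k.succ) =
        ∫⁻ y, (∏ k, r (Fin.succ k) (y k)) * H (Fin.cons (f 0 x) y)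
          ∂(Measure.pi fun k => ν k.succ) := fun x =>
      ih (fun k => ν k.succ) (fun k => hf k.succ) (fun k => hr k.succ) _ (hc _)
    simp only [h₁]
    have hm : Measurable fun x => ∫⁻ y, (∏ k, r (Fin.succ k) (y k)) * H (Fin.cons x y)
          ∂(Measure.pi fun k => ν k.succ) :=
      Measurable.lintegral_prod_right' (((hR _ _ fun k => (hr (Fin.succ k)).1).comp
        measurable_snd).mul (hH.comp measurable_fin_cons))
    rw [(hr 0).2 _ hm]
    refine lintegral_congr fun x => ?_
    have hm' : Measurable fun y : Fin p → E => (∏ k, r (Fin.succ k) (y k)) * H (Fin.cons x y) :=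
      (hR _ _ fun k => (hr (Fin.succ k)).1).mul (hc _)
    rw [id, ← lintegral_const_mul _ hm']
    refine lintegral_congr fun y => ?_
    simp [Fin.prod_univ_succ, mul_assoc]

/-- The likelihood ratio of `Laplace(0, s)^p` translated by `d` and `Laplace(0, s)^p`. -/
def laplaceRatio {p : ℕ} (s : ℝ) (d x : Params p) : ℝ :=
  Real.exp ((∑ k, (|x k| - |x k - d k|)) / s)

theorem isLikelihoodRatio_laplaceVector {p : ℕ} {s : ℝ} {d : Params p} (hs : 0 ≤ s)
    (hd : s = 0 → d = 0) :
    IsLikelihoodRatio (laplaceVector p s) (fun x => x + d) id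
      fun x => ENNReal.ofReal (laplaceRatio s d x) := by
  have hm : Measurable fun x => ENNReal.ofReal (laplaceRatio s d x) := by
    unfold laplaceRatio; fun_prop
  refine ⟨hm, fun H hH => ?_⟩
  have hT : Measurable (WithLp.toLp 2 : (Fin p → ℝ) → Params p) := by fun_prop
  rw [laplaceVector, lintegral_map (by fun_prop) hT, lintegral_map (by fun_prop) hT]
  have h := (isLikelihoodRatio_pi (fun _ : Fin p => laplaceMeasure s)
    (f := fun k x => x + d k) (fun k => by fun_prop)
    fun k => isLikelihoodRatio_laplaceMeasure hs fun h => by simp [hd h]).2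
    (fun x => H (WithLp.toLp 2 x)) (hH.comp hT)
  have e : ∀ x : Fin p → ℝ, WithLp.toLp 2 x + d = WithLp.toLp 2 fun k => x k + d k :=
    fun x => rfl
  simp only [e, h]
  refine lintegral_congr fun x => ?_
  simp only [laplaceRatio, id]
  rw [Finset.sum_div, Real.exp_sum, ENNReal.ofReal_prod_of_nonneg fun _ _ => (Real.exp_pos _).le]

/-- The reverse triangle inequality in each coordinate is why sensitivity is measured in the
L1-norm. -/
theorem laplaceRatio_mem_Icc {p : ℕ} {s ε : ℝ} (hs : 0 ≤ s) (hε : 0 ≤ ε) {d : Params p}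
    (hd : ∑ k, |d k| ≤ ε * s) (x : Params p) :
    laplaceRatio s d x ∈ Set.Icc (Real.exp (-ε)) (Real.exp ε) := by
  have h : |∑ k, (|x k| - |x k - d k|)| ≤ ε * s :=
    (Finset.abs_sum_le_sum_abs _ _).trans ((Finset.sum_le_sum fun k _ => by
      simpa using abs_abs_sub_abs_le_abs_sub (x k) (x k - d k)).trans hd)
  obtain ⟨h₁, h₂⟩ := abs_le.1 h
  simp only [laplaceRatio, Set.mem_Icc, Real.exp_le_exp]
  rcases hs.eq_or_lt with rfl | hs
  · simp [hε]
  · exact ⟨by rw [le_div_iff₀ hs]; linarith, by rwa [div_le_iff₀ hs]⟩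

/-! ### Moments of bounded likelihood ratios -/

/-- The `(1 + l)`-th moment of the likelihood ratio of `ε`-randomized response. -/
def responseMoment (ε l : ℝ) : ℝ :=
  (Real.exp (-(l * ε)) + Real.exp ε * Real.exp (l * ε)) / (Real.exp ε + 1)

theorem responseMoment_nonneg (ε l : ℝ) : 0 ≤ responseMoment ε l := by
  unfold responseMoment; positivity

theorem responseMoment_le_exp {ε l : ℝ} (hε : 0 ≤ ε) (hl : 0 ≤ l) :
    responseMoment ε l ≤ Real.exp (l * ε) := by
  have h : Real.exp (-(l * ε)) ≤ Real.exp (l * ε) := by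
    gcongr; nlinarith [mul_nonneg hl hε]
  rw [responseMoment, div_le_iff₀ (by positivity)]
  linarith

/-- Hoeffding's lemma for randomized response. -/
theorem responseMoment_le_exp_add_sq (ε l : ℝ) :
    responseMoment ε l ≤
      Real.exp (l * ((Real.exp ε - 1) * ε / (Real.exp ε + 1)) + l ^ 2 * ε ^ 2 / 2) := by
  have hb : 0 < Real.exp ε + 1 := by positivity
  set p : ℝ≥0∞ := ENNReal.ofReal (Real.exp ε / (Real.exp ε + 1)) with hp
  set p' : ℝ≥0∞ := ENNReal.ofReal (1 / (Real.exp ε + 1)) with hp'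
  -- The law of the privacy loss of randomized response: its mean is the term `M` below, and its
  -- moment generating function at `l` is `responseMoment ε l`.
  set μ : Measure ℝ := p • Measure.dirac ε + p' • Measure.dirac (-ε) with hμ
  have hprob : IsProbabilityMeasure μ := by
    constructor
    simp only [hμ, Measure.add_apply, Measure.smul_apply, measure_univ, smul_eq_mul, mul_one]
    rw [hp, hp', ← ENNReal.ofReal_add (by positivity) (by positivity), ← add_div,
      div_self hb.ne', ENNReal.ofReal_one]
  have hint : ∀ g : ℝ → ℝ, ∫ x, g x ∂μ =
      (Real.exp ε * g ε + g (-ε)) / (Real.exp ε + 1) := by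
    intro g
    rw [hμ, integral_add_measure, integral_smul_measure, integral_smul_measure,
      integral_dirac, integral_dirac, hp, hp', ENNReal.toReal_ofReal (by positivity),
      ENNReal.toReal_ofReal (by positivity)]
    · simp only [smul_eq_mul]; field_simp
    · exact (integrable_dirac (by simp)).smul_measure ENNReal.ofReal_ne_top
    · exact (integrable_dirac (by simp)).smul_measure ENNReal.ofReal_ne_top
  have hmem : ∀ᵐ x ∂μ, id x ∈ Set.Icc (-|ε|) |ε| := by
    rw [hμ, ae_add_measure_iff]
    constructor <;> refine Measure.ae_smul_measure ?_ _ <;> rw [ae_dirac_eq] <;>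
      simp [Filter.eventually_pure, le_abs_self, neg_le_abs, neg_le]
  have h := (hasSubgaussianMGF_of_mem_Icc aemeasurable_id hmem).mgf_le l
  rw [mgf, hint, hint] at h
  have hc : (((‖|ε| - -|ε|‖₊ / 2) ^ 2 : ℝ≥0) : ℝ) = ε ^ 2 := by
    have : ‖|ε| - -|ε|‖ = 2 * |ε| := by
      rw [Real.norm_eq_abs, abs_of_nonneg] <;> linarith [abs_nonneg ε]
    push_cast
    rw [this, mul_div_cancel_left₀ _ two_ne_zero, sq_abs]
  rw [hc] at h
  set M := (Real.exp ε - 1) * ε / (Real.exp ε + 1) with hM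
  have hM' : (Real.exp ε * id ε + id (-ε)) / (Real.exp ε + 1) = M := by
    rw [hM]; simp only [id]; ring
  rw [hM'] at h
  have e : responseMoment ε l = Real.exp (l * M) *
      ((Real.exp ε * Real.exp (l * (id ε - M)) + Real.exp (l * (id (-ε) - M))) /
        (Real.exp ε + 1)) := by
    have e₁ : Real.exp (l * ε) = Real.exp (l * M) * Real.exp (l * (id ε - M)) := by
      rw [← Real.exp_add, id]; ring_nf
    have e₂ : Real.exp (-(l * ε)) = Real.exp (l * M) * Real.exp (l * (id (-ε) - M)) := by
      rw [← Real.exp_add, id]; ring_nf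
    rw [responseMoment, e₁, e₂]
    ring
  rw [e, Real.exp_add]
  gcongr
  refine h.trans (le_of_eq ?_)
  congr 1
  ring

/-- The chord of the convex function `x ^ (1 + l)` over `[exp (-ε), exp ε]`. -/
theorem exists_rpow_le_chord {ε l : ℝ} (hε : 0 < ε) (hl : 0 ≤ l) :
    ∃ A B : ℝ, A + B = responseMoment ε l ∧
      ∀ x ∈ Set.Icc (Real.exp (-ε)) (Real.exp ε), x ^ (1 + l) ≤ A + B * x := by
  set a := Real.exp (-ε) with ha
  set b := Real.exp ε with hb
  have ha0 : 0 < a := Real.exp_pos _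
  have hab : a < b := by rw [ha, hb]; gcongr; linarith
  have hab1 : a * b = 1 := by rw [ha, hb, ← Real.exp_add]; simp
  -- Intercept and slope of the chord; `A + B` is its height at `1`, the mean of a likelihood ratio.
  refine ⟨(b * a ^ (1 + l) - a * b ^ (1 + l)) / (b - a),
    (b ^ (1 + l) - a ^ (1 + l)) / (b - a), ?_, fun x hx => ?_⟩
  · have h₁ : a ^ (1 + l) = a * Real.exp (-(l * ε)) := by
      rw [Real.rpow_add ha0, Real.rpow_one, ha, ← Real.exp_mul]; ring_nf
    have h₂ : b ^ (1 + l) = b * Real.exp (l * ε) := by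
      rw [Real.rpow_add (Real.exp_pos _), Real.rpow_one, hb, ← Real.exp_mul]; ring_nf
    have hba : b - a ≠ 0 := by linarith
    have hb1 : b + 1 ≠ 0 := by positivity
    rw [h₁, h₂, responseMoment, ← hb, ← add_div, div_eq_div_iff hba hb1]
    have ha' : a = b⁻¹ := eq_inv_of_mul_eq_one_left hab1
    have hb0 : b ≠ 0 := (Real.exp_pos _).ne'
    rw [ha']
    field_simp
    ring
  · have hc := (convexOn_rpow (p := 1 + l) (by linarith)).2 ha0.le (ha0.le.trans hab.le)
      (div_nonneg (sub_nonneg.2 hx.2) (sub_nonneg.2 hab.le))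
      (div_nonneg (sub_nonneg.2 hx.1) (sub_nonneg.2 hab.le))
      (by rw [← add_div, div_eq_one_iff_eq (by linarith)]; ring)
    have hba : b - a ≠ 0 := by linarith
    simp only [smul_eq_mul] at hc
    rw [show (b - x) / (b - a) * a + (x - a) / (b - a) * b = x by field_simp; ring] at hc
    refine hc.trans (le_of_eq ?_)
    field_simp
    ring

/-- Integrating the chord bound uses only the mean of `r`, which is one; randomized response is
extremal because it lives on the endpoints. -/
theorem lintegral_rpow_le_responseMoment {E : Type*} [MeasurableSpace E] (ν : Measure E)
    [IsProbabilityMeasure ν] {r : E → ℝ} (hr : Measurable r) {ε l : ℝ} (hε : 0 ≤ ε) (hl : 0 ≤ l)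
    (hmem : ∀ x, r x ∈ Set.Icc (Real.exp (-ε)) (Real.exp ε))
    (hint : ∫⁻ x, ENNReal.ofReal (r x) ∂ν = 1) :
    ∫⁻ x, ENNReal.ofReal (r x) ^ (1 + l) ∂ν ≤ ENNReal.ofReal (responseMoment ε l) := by
  have hpos : ∀ x, 0 < r x := fun x => (Real.exp_pos _).trans_le (hmem x).1
  simp only [ENNReal.ofReal_rpow_of_pos (hpos _)]
  -- At `ε = 0` the interval collapses to a point and there is no chord.
  rcases hε.eq_or_lt with rfl | hε
  · have h1 : ∀ x, r x = 1 := fun x => le_antisymm (by simpa using (hmem x).2)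
      (by simpa using (hmem x).1)
    simp [h1, responseMoment]
  · obtain ⟨A, B, hAB, hle⟩ := exists_rpow_le_chord hε hl
    have hri : Integrable r ν := by
      refine Integrable.of_mem_Icc _ _ hr.aemeasurable (Filter.Eventually.of_forall hmem)
    have hr1 : ∫ x, r x ∂ν = 1 := by
      rw [integral_eq_lintegral_of_nonneg_ae (Filter.Eventually.of_forall fun x => (hpos x).le)
        hr.aestronglyMeasurable, hint, ENNReal.toReal_one]
    have hnn : ∀ x, 0 ≤ A + B * r x := fun x =>
      (Real.rpow_nonneg (hpos x).le _).trans (hle _ (hmem x))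
    calc ∫⁻ x, ENNReal.ofReal (r x ^ (1 + l)) ∂ν
        ≤ ∫⁻ x, ENNReal.ofReal (A + B * r x) ∂ν :=
          lintegral_mono fun x => ENNReal.ofReal_le_ofReal (hle _ (hmem x))
      _ = ENNReal.ofReal (∫ x, (A + B * r x) ∂ν) :=
          (ofReal_integral_eq_lintegral_ofReal ((integrable_const A).add (hri.const_mul B))
            (Filter.Eventually.of_forall hnn)).symm
      _ = ENNReal.ofReal (responseMoment ε l) := by
          rw [integral_add (integrable_const A) (hri.const_mul B), integral_const_mul, hr1]
          simp [← hAB]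

/-! ### The overall privacy parameter -/

/-- Two tangent lines: `l * (1 - exp (-u)) ≤ l * u ≤ exp (l * u) - 1`. -/
theorem one_sub_exp_neg_le {l : ℝ} (hl : 0 < l) (u : ℝ) :
    1 - Real.exp (-u) ≤ l⁻¹ * Real.exp (l * u) := by
  rw [inv_mul_eq_div, le_div_iff₀ hl]
  nlinarith [Real.add_one_le_exp (-u), Real.add_one_le_exp (l * u)]

theorem one_sub_exp_neg_le' {l : ℝ} (hl : 0 ≤ l) (u : ℝ) :
    1 - Real.exp (-u) ≤ 1 * Real.exp (l * u) := by
  rcases le_total 0 u with hu | hu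
  · have : 1 ≤ Real.exp (l * u) := Real.one_le_exp (mul_nonneg hl hu)
    linarith [Real.exp_pos (-u)]
  · have : 1 ≤ Real.exp (-u) := Real.one_le_exp (by linarith)
    linarith [Real.exp_pos (l * u)]

/-- The tangent inequality behind the bound of a hockey-stick divergence by a Rényi moment. -/
theorem le_exp_add_rpow {l C : ℝ} (hl : 0 ≤ l) (hC : 0 < C)
    (h : ∀ u, 1 - Real.exp (-u) ≤ C * Real.exp (l * u)) (κ : ℝ) (a : ℝ≥0∞) :
    a ≤ ENNReal.ofReal (Real.exp κ) +
      ENNReal.ofReal (C * Real.exp (-(l * κ))) * a ^ (1 + l) := by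
  rcases eq_or_ne a ⊤ with rfl | ha
  · rw [ENNReal.top_rpow_of_pos (by linarith), ENNReal.mul_top]
    · simp
    · simpa using mul_pos hC (Real.exp_pos _)
  lift a to ℝ≥0 using ha
  rcases eq_or_ne a 0 with rfl | ha
  · simp
  have hapos : 0 < (a : ℝ) := by positivity
  obtain ⟨v, hv⟩ : ∃ v, Real.exp v = a := ⟨Real.log a, Real.exp_log hapos⟩
  rw [← ENNReal.ofReal_coe_nnreal, ENNReal.ofReal_rpow_of_pos hapos,
    ← ENNReal.ofReal_mul (by positivity), ← ENNReal.ofReal_add (by positivity) (by positivity)]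
  refine ENNReal.ofReal_le_ofReal ?_
  rw [← hv, ← Real.exp_mul]
  -- With `a = exp v`, the claim is the hypothesis at `u = v - κ`, scaled by `exp v`.
  have h' := mul_le_mul_of_nonneg_left (h (v - κ)) (Real.exp_pos v).le
  have e₁ : Real.exp v * (1 - Real.exp (-(v - κ))) = Real.exp v - Real.exp κ := by
    rw [mul_sub, mul_one, ← Real.exp_add]; ring_nf
  have e₂ : Real.exp v * (C * Real.exp (l * (v - κ))) =
      C * Real.exp (-(l * κ)) * Real.exp (v * (1 + l)) := by
    rw [mul_left_comm, ← Real.exp_add, mul_assoc, ← Real.exp_add]; ring_nf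
  linarith

/-- If `a - exp κ * b` is controlled by the moments of randomized response for all orders, then
it is at most `δ` for the overall privacy parameter `κ`. -/
theorem le_exp_overallEpsilon {ι : Type*} (A : Finset ι) {ε : ι → ℝ} (hε : ∀ t ∈ A, 0 < ε t)
    {δ : ℝ} (hδ : δ ∈ Set.Icc (0 : ℝ) 1) {a b : ℝ}
    (h : ∀ l C κ : ℝ, 0 ≤ l → 0 < C → (∀ u, 1 - Real.exp (-u) ≤ C * Real.exp (l * u)) →
      a ≤ Real.exp κ * b + C * Real.exp (-(l * κ)) * ∏ t ∈ A, responseMoment (ε t) l) :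
    a ≤ Real.exp (overallEpsilon A ε δ) * b + δ := by
  have hpure : a ≤ Real.exp (∑ t ∈ A, ε t) * b + δ := by
    suffices h0 : a ≤ Real.exp (∑ t ∈ A, ε t) * b by linarith [hδ.1]
    refine le_of_forall_pos_le_add fun x hx => ?_
    -- Order `l = 1 / x` with `C = x`: the moments cancel `exp (-(l * κ))` exactly, leaving an error
    -- `x` that tends to zero.
    refine (h x⁻¹ x (∑ t ∈ A, ε t) (by positivity) hx fun u => ?_).trans ?_
    · simpa using one_sub_exp_neg_le (inv_pos.2 hx) u
    · gcongr
      have : ∏ t ∈ A, responseMoment (ε t) x⁻¹ ≤ Real.exp (x⁻¹ * ∑ t ∈ A, ε t) := by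
        rw [Finset.mul_sum, Real.exp_sum]
        exact Finset.prod_le_prod (fun t _ => responseMoment_nonneg _ _) fun t ht =>
          responseMoment_le_exp (hε t ht).le (by positivity)
      calc _ ≤ x * Real.exp (-(x⁻¹ * ∑ t ∈ A, ε t)) * Real.exp (x⁻¹ * ∑ t ∈ A, ε t) := by gcongr
        _ = x := by rw [mul_assoc, ← Real.exp_add]; simp
  unfold overallEpsilon
  split_ifs with hδ0
  · exact hpure
  have hδ' : 0 < δ := lt_of_le_of_ne hδ.1 (Ne.symm hδ0)
  rcases A.eq_empty_or_nonempty with rfl | hA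
  · simpa using hpure
  set V := ∑ t ∈ A, ε t ^ 2 with hV
  set M := ∑ t ∈ A, (Real.exp (ε t) - 1) * ε t / (Real.exp (ε t) + 1) with hM
  have hVpos : 0 < V := Finset.sum_pos (fun t ht => by have := hε t ht; positivity) hA
  have hsum : ∀ L, ∑ t ∈ A, 2 * ε t ^ 2 * L = 2 * V * L := fun L => by
    rw [hV, Finset.mul_sum, Finset.sum_mul]
  have hprod : ∀ l, ∏ t ∈ A, responseMoment (ε t) l ≤ Real.exp (l * M + l ^ 2 * V / 2) := by
    intro l
    rw [hM, hV, Finset.mul_sum, Finset.mul_sum, Finset.sum_div, ← Finset.sum_add_distrib,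
      Real.exp_sum]
    exact Finset.prod_le_prod (fun t _ => responseMoment_nonneg _ _) fun t ht =>
      responseMoment_le_exp_add_sq _ _
  have key : ∀ L C : ℝ, 0 ≤ L → 0 < C →
      (∀ u, 1 - Real.exp (-u) ≤ C * Real.exp (√(2 * V * L) / V * u)) →
      C * Real.exp (-L) ≤ δ → a ≤ Real.exp (M + √(2 * V * L)) * b + δ := by
    intro L C hL hC hu hCL
    set x := √(2 * V * L)
    have hx : x ^ 2 = 2 * V * L := Real.sq_sqrt (by positivity)
    -- `l = x / V` minimizes `-l * x + l ^ 2 * V / 2`, the exponent left when `κ = M + x`; the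
    -- minimum is `-x ^ 2 / (2 * V) = -L`.
    refine (h (x / V) C (M + x) (by positivity) hC hu).trans ?_
    gcongr
    refine le_trans ?_ hCL
    rw [mul_assoc]
    gcongr
    refine (mul_le_mul_of_nonneg_left (hprod _) (Real.exp_pos _).le).trans (le_of_eq ?_)
    rw [← Real.exp_add]
    congr 1
    field_simp
    linear_combination (-1 : ℝ) * hx
  simp only [hsum]
  rcases min_choice (∑ t ∈ A, ε t) (min (M + √(2 * V * Real.log (Real.exp 1 + √V / δ)))
    (M + √(2 * V * Real.log (1 / δ)))) with e | e
  · rw [e]; exact hpure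
  rw [e]
  rcases min_choice (M + √(2 * V * Real.log (Real.exp 1 + √V / δ)))
    (M + √(2 * V * Real.log (1 / δ))) with e | e
  · rw [e]
    -- The summand `e` inside the logarithm ensures `L ≥ 1`, whence `C = 1 / l = V / √(2 * V * L) ≤
    -- √V`.
    have hL : 1 ≤ Real.log (Real.exp 1 + √V / δ) := by
      rw [Real.le_log_iff_exp_le (by positivity)]
      exact le_add_of_nonneg_right (by positivity)
    set L := Real.log (Real.exp 1 + √V / δ) with hLdef
    have hx : 0 < √(2 * V * L) := Real.sqrt_pos.2 (by positivity)
    refine key L (√(2 * V * L) / V)⁻¹ (by linarith) (by positivity)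
      (one_sub_exp_neg_le (by positivity)) ?_
    rw [hLdef, Real.exp_neg, Real.exp_log (by positivity), ← hLdef, inv_div]
    have h₁ : V / √(2 * V * L) ≤ √V := by
      rw [div_le_iff₀ hx, ← Real.sqrt_mul hVpos.le]
      refine Real.le_sqrt_of_sq_le ?_
      nlinarith [mul_pos hVpos hVpos]
    rw [← div_eq_mul_inv, div_le_iff₀ (by positivity), mul_add, mul_div_cancel₀ _ hδ'.ne']
    have : 0 < δ * Real.exp 1 := by positivity
    linarith
  · rw [e]
    have hL : 0 ≤ Real.log (1 / δ) := Real.log_nonneg (by rw [le_div_iff₀ hδ']; linarith [hδ.2])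
    refine key _ 1 hL one_pos (one_sub_exp_neg_le' (by positivity)) ?_
    rw [Real.exp_neg, Real.exp_log (by positivity)]
    simp

/-! ### Sensitivity of the gradients -/

/-- Replacing one data point changes the gradient of an empirical loss by at most `2 L / m` in the
`L1`-norm. -/
theorem sum_abs_gradient_sub_le {p m : ℕ} {Z : Type*} {ℓ : Params p → Z → ℝ}
    {L : ℝ} (hℓ : ∀ z, LipschitzInL1 (fun θ => ℓ θ z) L) {F : Params p → (Fin m → Z) → ℝ}
    {R : Params p → ℝ} (hF : ∀ θ S, F θ S = (1 / (m : ℝ)) * (∑ k, ℓ θ (S k)) + R θ)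
    (hdiff : ∀ S, Differentiable ℝ fun θ => F θ S) {S S' : Fin m → Z}
    (hS : Neighboring S S') (θ : Params p) :
    ∑ k, |(gradient (fun θ => F θ S) θ - gradient (fun θ => F θ S') θ) k| ≤ 2 * L / m := by
  obtain ⟨k₀, hk₀⟩ := hS
  -- Writing one loss as the other plus a difference of two sample losses cancels `R`, so `R` itself
  -- need not be differentiable.
  have hFS : (fun θ => F θ S) =
      fun θ => F θ S' + (1 / (m : ℝ)) * (ℓ θ (S k₀) - ℓ θ (S' k₀)) := by
    funext θ
    have h : ∑ k, ℓ θ (S k) - ∑ k, ℓ θ (S' k) = ℓ θ (S k₀) - ℓ θ (S' k₀) := by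
      rw [← Finset.sum_sub_distrib]
      refine Finset.sum_eq_single k₀ (fun k _ hk => ?_) (by simp)
      rw [hk₀ k hk, sub_self]
    rw [hF, hF, ← h]
    ring
  have hd := fun z => (hℓ z).1 θ
  have hgrad : gradient (fun θ => F θ S) θ - gradient (fun θ => F θ S') θ =
      (1 / (m : ℝ)) • (gradient (fun θ => ℓ θ (S k₀)) θ - gradient (fun θ => ℓ θ (S' k₀)) θ) := by
    rw [hFS]
    unfold gradient
    rw [fderiv_fun_add (hdiff S' θ) (((hd _).fun_sub (hd _)).const_mul _),
      fderiv_const_mul ((hd _).fun_sub (hd _)), fderiv_fun_sub (hd _) (hd _)]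
    simp only [map_add, map_smul, map_sub, add_sub_cancel_left]
  rw [hgrad]
  calc _ ≤ ∑ k, (1 / (m : ℝ)) * (|gradient (fun θ => ℓ θ (S k₀)) θ k| +
          |gradient (fun θ => ℓ θ (S' k₀)) θ k|) := by
        refine Finset.sum_le_sum fun k _ => ?_
        rw [PiLp.smul_apply, PiLp.sub_apply, smul_eq_mul, abs_mul,
          abs_of_nonneg (by positivity : (0 : ℝ) ≤ 1 / m)]
        gcongr
        exact abs_sub _ _
    _ = (1 / (m : ℝ)) * (∑ k, |gradient (fun θ => ℓ θ (S k₀)) θ k| +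
          ∑ k, |gradient (fun θ => ℓ θ (S' k₀)) θ k|) := by
        rw [← Finset.mul_sum, Finset.sum_add_distrib]
    _ ≤ (1 / (m : ℝ)) * (L + L) := by
        gcongr
        · exact (hℓ _).2 θ
        · exact (hℓ _).2 θ
    _ = 2 * L / m := by ring

/-! ### The algorithm as an adaptive composition of Laplace steps -/

namespace LearningProblem

variable {n p T : ℕ} {m : Fin n → ℕ} {X Y : Type*} (P : LearningProblem n p m X Y)

/-- The iteration in which agent `j` wakes up, as a map of the state and of the noise. -/
def wakeUp (S : ∀ j, Dataset X Y (m j)) (j : Fin n) (Θ : Fin n → Params p) (η : Params p) :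
    Fin n → Params p :=
  Function.update Θ j (P.noisyUpdate j (S j) Θ η)

theorem measurable_wakeUp (S : ∀ j, Dataset X Y (m j)) (j : Fin n) :
    Measurable (Function.uncurry (P.wakeUp S j)) := by
  have hg : Measurable (gradient fun θ => P.localLoss j θ (S j)) :=
    (P.lipschitz_gradient j (S j)).continuous.measurable
  have hΘ : ∀ k, Measurable fun z : (Fin n → Params p) × Params p => z.1 k := fun k =>
    (measurable_pi_apply k).comp measurable_fst
  refine measurable_pi_iff.2 fun k => ?_
  rcases eq_or_ne k j with rfl | hk
  · simp only [Function.uncurry_def, wakeUp, Function.update_self, noisyUpdate]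
    have hsum : Measurable fun z : (Fin n → Params p) × Params p =>
        ∑ j with 0 < P.W k j, (P.W k j / P.degree k) • z.1 j :=
      Finset.measurable_fun_sum _ fun j _ => (hΘ j).const_smul (P.W k j / P.degree k)
    exact ((hΘ k).const_smul (1 - P.stepSize k)).add ((hsum.sub
      (((hg.comp (hΘ k)).add measurable_snd).const_smul (P.μ * P.c k))).const_smul (P.stepSize k))
  · simp only [Function.uncurry_def, wakeUp, Function.update_of_ne hk]
    exact hΘ k

/-- Gradient and noise enter only through their sum, so a change of dataset is a translation of the
noise, whatever the step size. -/
theorem noisyUpdate_add (j : Fin n) (S S' : Dataset X Y (m j)) (Θ : Fin n → Params p)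
    (η : Params p) :
    P.noisyUpdate j S' Θ (η + (gradient (fun θ => P.localLoss j θ S) (Θ j) -
      gradient (fun θ => P.localLoss j θ S') (Θ j))) = P.noisyUpdate j S Θ η := by
  unfold noisyUpdate
  congr 4
  abel

theorem exists_isLikelihoodRatio_wakeUp (j : Fin n) {S S' : ∀ j, Dataset X Y (m j)}
    (Θ : Fin n → Params p) {s ε l : ℝ} (hs : 0 ≤ s) (hε : 0 ≤ ε) (hl : 0 ≤ l)
    [IsProbabilityMeasure (laplaceVector p s)]
    (hd : ∑ k, |(gradient (fun θ => P.localLoss j θ (S j)) (Θ j) -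
      gradient (fun θ => P.localLoss j θ (S' j)) (Θ j)) k| ≤ ε * s) :
    ∃ r, IsLikelihoodRatio (laplaceVector p s) (P.wakeUp S j Θ) (P.wakeUp S' j Θ) r ∧
      ∫⁻ y, r y ^ (1 + l) ∂laplaceVector p s ≤ ENNReal.ofReal (responseMoment ε l) := by
  set d := gradient (fun θ => P.localLoss j θ (S j)) (Θ j) -
    gradient (fun θ => P.localLoss j θ (S' j)) (Θ j) with hd_def
  have hd0 : s = 0 → d = 0 := by
    rintro rfl
    rw [mul_zero] at hd
    have h := (Finset.sum_eq_zero_iff_of_nonneg fun k _ => abs_nonneg (d k)).1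
      (le_antisymm hd (Finset.sum_nonneg fun k _ => abs_nonneg _))
    ext k
    simpa using h k (Finset.mem_univ k)
  obtain ⟨hr, hH⟩ := isLikelihoodRatio_laplaceVector hs hd0
  refine ⟨_, ⟨hr, fun H hHm => ?_⟩, lintegral_rpow_le_responseMoment _
    (by unfold laplaceRatio; fun_prop) hε hl (laplaceRatio_mem_Icc hs hε hd) ?_⟩
  · refine Eq.trans ?_ (hH (fun y => H (P.wakeUp S' j Θ y))
      (hHm.comp ((P.measurable_wakeUp S' j).comp measurable_prodMk_left)))
    simp only [wakeUp, hd_def, noisyUpdate_add]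
  -- Testing the ratio against the constant `1` shows that its mean is one.
  · simpa using (hH (fun _ => 1) measurable_const).symm

theorem measurable_broadcast (w : Fin T → Fin n) (i : Fin n) (S : ∀ j, Dataset X Y (m j)) :
    Measurable fun z : (Fin n → Params p) × (Fin T → Params p) =>
      P.broadcast w i S z.1 z.2 := by
  refine measurable_pi_iff.2 fun t => ?_
  exact (measurable_pi_apply i).comp ((measurable_pi_apply t.1.succ).comp
    (measurable_trajectory fun t => P.measurable_wakeUp S (w t)))

/-- Differential privacy of the broadcast sequence for a deterministic initial point. -/
theorem measure_broadcast_le (w : Fin T → Fin n) (i : Fin n) {S S' : ∀ j, Dataset X Y (m j)}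
    (hne : ∀ j, j ≠ i → S j = S' j) {s : Fin T → ℝ} (hs : ∀ t, 0 ≤ s t)
    [∀ t, IsProbabilityMeasure (laplaceVector p (s t))]
    {ε : Fin T → ℝ} (hε : ∀ t, w t = i → 0 < ε t)
    (hd : ∀ t θ, w t = i → ∑ k, |(gradient (fun θ => P.localLoss i θ (S i)) θ -
      gradient (fun θ => P.localLoss i θ (S' i)) θ) k| ≤ ε t * s t)
    {δ : ℝ} (hδ : δ ∈ Set.Icc (0 : ℝ) 1) (Θ : Fin n → Params p)
    {O : Set ({t : Fin T // w t = i} → Params p)} (hO : MeasurableSet O) :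
    Measure.pi (fun t => laplaceVector p (s t)) {η | P.broadcast w i S Θ η ∈ O} ≤
      ENNReal.ofReal (Real.exp (overallEpsilon (Finset.univ.filter fun t => w t = i) ε δ)) *
        Measure.pi (fun t => laplaceVector p (s t)) {η | P.broadcast w i S' Θ η ∈ O} +
      ENNReal.ofReal δ := by
  set μ := Measure.pi fun t => laplaceVector p (s t)
  set A : Finset (Fin T) := Finset.univ.filter fun t => w t = i
  have hmeas : ∀ S, MeasurableSet {η | P.broadcast w i S Θ η ∈ O} := fun S =>
    (P.measurable_broadcast w i S).comp measurable_prodMk_left hO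
  set G : (Fin (T + 1) → Fin n → Params p) → ℝ≥0∞ :=
    Set.indicator {z | (fun t : {t : Fin T // w t = i} => z t.1.succ i) ∈ O} 1
  have hG : Measurable G := by
    refine measurable_one.indicator (measurableSet_preimage (?_ : Measurable _) hO)
    exact measurable_pi_iff.2 fun t =>
      (measurable_pi_apply i).comp (measurable_pi_apply t.1.succ)
  have hGint : ∀ S, ∫⁻ η, G (trajectory (fun t => P.wakeUp S (w t)) Θ η) ∂μ =
      μ {η | P.broadcast w i S Θ η ∈ O} := fun S => by
    rw [← lintegral_indicator_one (hmeas S)]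
    rfl
  have key : ∀ l C κ : ℝ, 0 ≤ l → 0 < C → (∀ u, 1 - Real.exp (-u) ≤ C * Real.exp (l * u)) →
      μ.real {η | P.broadcast w i S Θ η ∈ O} ≤
        Real.exp κ * μ.real {η | P.broadcast w i S' Θ η ∈ O} +
          C * Real.exp (-(l * κ)) * ∏ t ∈ A, responseMoment (ε t) l := by
    intro l C κ hl hC hu
    have h := lintegral_trajectory_le (q := 1 + l) (by linarith) (le_exp_add_rpow hl hC hu κ)
      (fun t => laplaceVector p (s t)) (fun t => P.measurable_wakeUp S (w t))
      (fun t => P.measurable_wakeUp S' (w t))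
      -- Steps of other agents get privacy parameter `0`, whose moment is `1`, so they drop out of
      -- the product.
      (fun t => ENNReal.ofReal (responseMoment (if w t = i then ε t else 0) l))
      (fun t Θ => P.exists_isLikelihoodRatio_wakeUp (w t) Θ (hs t)
        (by split_ifs with h; exacts [(hε t h).le, le_rfl]) hl ?_) hG
      (fun z => Set.indicator_le_self' (by simp) z) Θ 1
    · rw [hGint, hGint, one_mul, ENNReal.one_rpow, mul_one,
        ← ENNReal.ofReal_prod_of_nonneg fun t _ => responseMoment_nonneg _ _,
        ← ENNReal.ofReal_mul (by positivity)] at h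
      have hprod : ∏ t, responseMoment (if w t = i then ε t else 0) l =
          ∏ t ∈ A, responseMoment (ε t) l := by
        rw [Finset.prod_filter]
        refine Finset.prod_congr rfl fun t _ => ?_
        split_ifs
        · rfl
        · simp [responseMoment]
      rw [hprod, ← ofReal_measureReal, ← ofReal_measureReal,
        ← ENNReal.ofReal_mul (Real.exp_pos _).le, ← ENNReal.ofReal_add (by positivity)
          (mul_nonneg (by positivity) (Finset.prod_nonneg fun t _ => responseMoment_nonneg _ _)),
        ENNReal.ofReal_le_ofReal_iff (add_nonneg (by positivity)
          (mul_nonneg (by positivity) (Finset.prod_nonneg fun t _ => responseMoment_nonneg _ _)))]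
        at h
      exact h
    · split_ifs with h
      · subst h
        exact hd t _ rfl
      · simp [hne _ h]
  have hfin := le_exp_overallEpsilon A (fun t ht => hε t (Finset.mem_filter.1 ht).2) hδ key
  rw [← ofReal_measureReal, ← ofReal_measureReal, ← ENNReal.ofReal_mul (Real.exp_pos _).le,
    ← ENNReal.ofReal_add (by positivity) hδ.1]
  exact ENNReal.ofReal_le_ofReal hfin

end LearningProblem

/-! ### Averaging over the initial point -/

/-- If a random input is independent of a product-distributed noise, the probability of an event
is obtained by integrating over the input. -/
theorem measure_eq_lintegral_pi {Ω A E : Type*} [MeasurableSpace Ω] [MeasurableSpace A]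
    [MeasurableSpace E] {T : ℕ} {Pr : Measure Ω} [IsProbabilityMeasure Pr] {a : Ω → A}
    (ha : Measurable a) {η : Fin T → Ω → E} (hη : ∀ t, Measurable (η t))
    {ν : Fin T → Measure E} [∀ t, IsProbabilityMeasure (ν t)] (hlaw : ∀ t, Pr.map (η t) = ν t)
    (hindep : iIndepFun η Pr) (hindep₀ : IndepFun a (fun ω t => η t ω) Pr)
    {B : Set (A × (Fin T → E))} (hB : MeasurableSet B) :
    Pr {ω | (a ω, fun t => η t ω) ∈ B} =
      ∫⁻ x, Measure.pi ν {y | (x, y) ∈ B} ∂Pr.map a := by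
  have hη' : Measurable fun ω t => η t ω := measurable_pi_iff.2 hη
  have h := (indepFun_iff_map_prod_eq_prod_map_map ha.aemeasurable hη'.aemeasurable).1 hindep₀
  rw [(iIndepFun_iff_map_fun_eq_pi_map fun t => (hη t).aemeasurable).1 hindep] at h
  simp only [hlaw] at h
  refine Eq.trans ?_ (Measure.prod_apply hB)
  rw [← h, Measure.map_apply (ha.prodMk hη') hB]
  rfl

end

theorem mainTheorem2 {n p T : ℕ} {m : Fin n → ℕ} {X Y : Type*}
    (P : LearningProblem n p m X Y)
    -- the local datasets and the wake-up schedule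
    (S : ∀ j, Dataset X Y (m j)) (w : Fin T → Fin n)
    -- the agent under consideration and the form of its local loss
    (i : Fin n) (hm : 0 < m i)
    (ℓ : Params p → X × Y → ℝ) (lam : ℝ) (hlam : 0 ≤ lam)
    (hloss : ∀ (θ : Params p) (Si : Dataset X Y (m i)),
      P.localLoss i θ Si = (1 / (m i : ℝ)) * (∑ k, ℓ θ (Si k)) + lam * ‖θ‖ ^ 2)
    (L₀ : ℝ) (hL₀ : 0 ≤ L₀) (hℓ : ∀ z : X × Y, LipschitzInL1 (fun θ => ℓ θ z) L₀)
    -- the noise scales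
    (s : Fin n → Fin T → ℝ) (hs : ∀ j t, 0 ≤ s j t)
    (ε : Fin T → ℝ) (hε : ∀ t, w t = i → 0 < ε t)
    (hscale : ∀ t, w t = i → s i t = 2 * L₀ / (ε t * m i))
    -- the random initial point and the independent noise vectors
    {Ω : Type*} [MeasurableSpace Ω] (Pr : Measure Ω) [IsProbabilityMeasure Pr]
    (Θ₀ : Ω → Fin n → Params p) (hΘ₀ : Measurable Θ₀)
    (η : Fin T → Ω → Params p) (hη : ∀ t, Measurable (η t))
    (hlaw : ∀ t, HasLaw (η t) (laplaceVector p (s (w t) t)) Pr)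
    (hindep : iIndepFun η Pr) (hindep₀ : IndepFun Θ₀ (fun ω t => η t ω) Pr)
    (δ : ℝ) (hδ : δ ∈ Set.Icc (0 : ℝ) 1) :
    IsDifferentiallyPrivate Pr (P.mechanism w i S Θ₀ η)
      (overallEpsilon (Finset.univ.filter fun t => w t = i) ε δ) δ := by
  intro D D' hD O hO
  have hprob : ∀ t, IsProbabilityMeasure (laplaceVector p (s (w t) t)) := fun t => by
    rw [← (hlaw t).map_eq]
    exact Measure.isProbabilityMeasure_map (hη t).aemeasurable
  have hPr : ∀ D, Pr {ω | P.mechanism w i S Θ₀ η D ω ∈ O} =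
      ∫⁻ Θ, Measure.pi (fun t => laplaceVector p (s (w t) t))
        {y | P.broadcast w i (Function.update S i D) Θ y ∈ O} ∂Pr.map Θ₀ := fun D =>
    measure_eq_lintegral_pi hΘ₀ hη (fun t => (hlaw t).map_eq) hindep hindep₀
      (P.measurable_broadcast w i (Function.update S i D) hO)
  have := Measure.isProbabilityMeasure_map (μ := Pr) hΘ₀.aemeasurable
  -- For fixed datasets and `δ` the bound is affine in the two probabilities, so it survives
  -- averaging over the initial point.
  rw [hPr, hPr, ← lintegral_const_mul' _ _ ENNReal.ofReal_ne_top]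
  refine (lintegral_mono fun Θ => P.measure_broadcast_le w i (S' := Function.update S i D')
          (fun j hj => by rw [Function.update_of_ne hj, Function.update_of_ne hj])
          (fun t => hs _ t) hε (fun t θ ht => ?_) hδ Θ hO).trans
    (le_of_eq ?_)
  swap
  · rw [lintegral_add_right _ measurable_const, lintegral_const, measure_univ, mul_one]
  rw [Function.update_self, Function.update_self]
  refine (sum_abs_gradient_sub_le hℓ hloss (P.differentiable_localLoss i) hD θ).trans (le_of_eq ?_)
  have hε' := (hε t ht).ne'
  have hm' : (m i : ℝ) ≠ 0 := by positivity
  rw [ht, hscale t ht]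
  field_simp
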